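/- Let $X=\mathbb{R}/\mathbb{Z}$ and let $\mathcal{M}(X)$ be the set of Borel probability measures on $X$ with the topology of weak convergence. For a sequence $\mathbf{x}=(x_k)_{k\ge 1}$ in $X$ put $\mu_{\mathbf{x},N}=\frac1N\sum_{k=1}^N\delta_{x_k}$ and let $M(\mathbf{x})=\bigcap_{N_0\ge1}\overline{\{\mu_{\mathbf{x},N}: N\ge N_0\}}\subseteq\mathcal{M}(X)$ be its set of limit measures. For a sequence $\mathbf{n}=(n_k)_{k\ge1}$ of positive integers and $\alpha\in X$ write $\mathbf{n}\alpha=(n_k\alpha)_{k\ge1}$. A property holds for generic $\alpha$ in $X$ (or in an open set $U\subseteq X$) if the set of $\alpha$ in $X$ (resp. $U$) without it is meager. Real intervals contained in $(0,1)$ are identified with their images in $X$. (1) For $\mathbf{n}=(2^k)_{k\ge1}$ there is a set $M\subseteq\mathcal{M}(X)$, namely the set of exactly those $\mu\in\mathcal{M}(X)$ that are invariant under $x\mapsto 2x$, such that $M(\mathbf{n}\alpha)=M$ for generic $\alpha\in X$. (2) For $\mathbf{n}'=(2^k+1)_{k\ge1}$ there is no set $M'\subseteq\mathcal{M}(X)$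 such that $M(\mathbf{n}'\alpha)=M'$ for generic $\alpha\in X$. Moreover, with $I=(\frac12,\frac34)$: for every $\alpha\in(0,\frac1{16})$ each $\mu\in M(\mathbf{n}'\alpha)$ satisfies $\mu(I)\le\frac56$, while for generic $\alpha\in(\frac12,\frac34)$ there is $\mu\in M(\mathbf{n}'\alpha)$ with $\mu(I)=1$. -/

import Mathlib

open MeasureTheory Filter Set
open scoped ENNReal NNReal

noncomputable section

/-- The set `A(x)` of accumulation points of a sequence: the intersection of the closures
of all its tails. -/
def accumulationPoints {ι X : Type*} [Preorder ι] [TopologicalSpace X] (x : ι → X) : Set X :=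
  ⋂ n₀ : ι, closure (x '' Set.Ici n₀)

/-- The measure `μ_{x,N} = (1/N) ∑_{n=1}^N δ_{x_n}`. The sequence is indexed by the positive
integers; the value `x 0` is never used. -/
def empiricalMeasure {X : Type*} [MeasurableSpace X] (x : ℕ → X) (N : ℕ+) : Measure X :=
  ((N : ℕ) : ℝ≥0∞)⁻¹ • ∑ n ∈ Finset.Icc 1 (N : ℕ), Measure.dirac (x n)

instance isProbabilityMeasure_empiricalMeasure {X : Type*} [MeasurableSpace X] (x : ℕ → X)
    (N : ℕ+) : IsProbabilityMeasure (empiricalMeasure x N) := by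
  constructor
  have h : ((N : ℕ) : ℝ≥0∞) ≠ 0 := by exact_mod_cast N.ne_zero
  simp [empiricalMeasure, Measure.smul_apply, Measure.finsetSum_apply,
    ENNReal.inv_mul_cancel h (ENNReal.natCast_ne_top _)]

/-- `μ_{x,N}` as an element of the space of Borel probability measures. -/
def empiricalProbabilityMeasure {X : Type*} [MeasurableSpace X] (x : ℕ → X) (N : ℕ+) :
    ProbabilityMeasure X :=
  ⟨empiricalMeasure x N, isProbabilityMeasure_empiricalMeasure x N⟩

/-- The set `M(x)` of limit measures of a sequence `x`: the accumulation points of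
`(μ_{x,N})_{N ≥ 1}` in the Borel probability measures with the topology of weak convergence. -/
def limitMeasures {X : Type*} [TopologicalSpace X] [MeasurableSpace X] [OpensMeasurableSpace X]
    (x : ℕ → X) : Set (ProbabilityMeasure X) :=
  accumulationPoints (empiricalProbabilityMeasure x)

/-- The sequence `nα = (n_k α)_k` in `ℝ/ℤ`. -/
def multiples (n : ℕ → ℕ) (α : UnitAddCircle) : ℕ → UnitAddCircle := fun k => n k • α

/-- The open arc of `ℝ/ℤ` that is the image of the real interval `(a, b)`. -/
def arc (a b : ℝ) : Set UnitAddCircle := (fun t : ℝ => (t : UnitAddCircle)) '' Set.Ioo a b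

/-- A measure on `ℝ/ℤ` is invariant under the doubling map `x ↦ 2x`. -/
def IsDoublingInvariant (μ : Measure UnitAddCircle) : Prop :=
  MeasurePreserving (fun x : UnitAddCircle => (2 : ℕ) • x) μ μ

end

/-! Limit measures along `2^k α` are always doubling-invariant, since the Birkhoff sums of `f ∘
doubling - f` telescope. Conversely, for an invariant `μ` the `α` whose empirical measures enter a
given neighbourhood of `μ` at arbitrarily late times form a dense open set; a countable basis and
Baire give the generic statement. Density rests on shadowing
(`exists_iterate_doubling_eq_and_dist_le`): orbit blocks can be concatenated freely, so attainable
averages are nearly convex and contain `∫ g ∂μ` (`integral_mem_reachableAverages`), without any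
ergodic theorem.

For `2^k + 1`, limit measures are those of `2^k α` translated by `α`. When `α` is small the
pulled-back arc cannot contain three consecutive orbit points, which bounds its mass; when `α` lies
in the arc, the invariant measure `δ_0` moves to `δ_α`. A single generic limit set would have to
satisfy both. -/

/-- The doubling map `x ↦ 2x` on `ℝ/ℤ`. -/
def doubling (x : UnitAddCircle) : UnitAddCircle := (2 : ℕ) • x

/-! ### Shadowing for the doubling map -/

lemma continuous_doubling : Continuous doubling := continuous_const_smul 2

lemma iterate_doubling (n : ℕ) (x : UnitAddCircle) : doubling^[n] x = (2 ^ n : ℕ) • x := by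
  induction n with
  | zero => simp
  | succ n ih => rw [Function.iterate_succ_apply', ih, doubling, smul_smul, pow_succ']

/-- Perturb `a` by `s / 2^n`, where `s ∈ [0, 1)` represents `b - 2^n a`: the error doubles at each
step and corrects the endpoint exactly at time `n`. -/
lemma exists_iterate_doubling_eq_and_dist_le (a b : UnitAddCircle) (n : ℕ) :
    ∃ x, doubling^[n] x = b ∧
      ∀ j ≤ n, dist (doubling^[j] x) (doubling^[j] a) ≤ 2 ^ j / 2 ^ n := by
  obtain ⟨s, hs, hs'⟩ : ∃ s ∈ Ico (0 : ℝ) 1, (s : UnitAddCircle) = b - (2 ^ n : ℕ) • a := by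
    refine ⟨AddCircle.equivIco 1 0 (b - (2 ^ n : ℕ) • a), ?_, AddCircle.coe_equivIco⟩
    simpa using (AddCircle.equivIco 1 0 (b - (2 ^ n : ℕ) • a)).2
  have key (j : ℕ) : (2 ^ j : ℕ) • ((s / 2 ^ n : ℝ) : UnitAddCircle)
      = ((2 ^ j * (s / 2 ^ n) : ℝ) : UnitAddCircle) := by
    rw [← AddCircle.coe_nsmul]
    simp
  refine ⟨a + ((s / 2 ^ n : ℝ) : UnitAddCircle), ?_, fun j _ => ?_⟩
  · rw [iterate_doubling, smul_add, key, mul_div_cancel₀ _ (by positivity), hs']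
    abel
  · rw [iterate_doubling, iterate_doubling, smul_add, dist_self_add_left, key]
    calc ‖((2 ^ j * (s / 2 ^ n) : ℝ) : UnitAddCircle)‖ ≤ ‖(2 ^ j * (s / 2 ^ n) : ℝ)‖ :=
          QuotientAddGroup.norm_mk_le_norm
      _ = 2 ^ j * (s / 2 ^ n) := by
          rw [Real.norm_of_nonneg]
          have := hs.1
          positivity
      _ ≤ 2 ^ j / 2 ^ n := by
          rw [mul_div_assoc']
          gcongr
          exact mul_le_of_le_one_right (by positivity) hs.2.le

/-! ### Attainable Birkhoff averages -/

section Reach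

variable {E : Type*} [NormedAddCommGroup E]

/-- Only a bounded number `K` of final steps can be far apart; uniform continuity handles the rest.
-/
lemma exists_norm_birkhoffSum_sub_le (g : C(UnitAddCircle, E)) {ε : ℝ} (hε : 0 < ε) :
    ∃ B : ℝ, ∀ (n : ℕ) (x a : UnitAddCircle),
      (∀ j ≤ n, dist (doubling^[j] x) (doubling^[j] a) ≤ 2 ^ j / 2 ^ n) →
      ‖birkhoffSum doubling g n x - birkhoffSum doubling g n a‖ ≤ n * ε + B := by
  obtain ⟨δ, hδ, hg⟩ := Metric.uniformContinuous_iff.1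
    (CompactSpace.uniformContinuous_of_continuous g.continuous) ε hε
  obtain ⟨K, hK⟩ := exists_pow_lt_of_lt_one hδ (by norm_num : (1 / 2 : ℝ) < 1)
  have hC (x y : UnitAddCircle) : ‖g x - g y‖ ≤ 2 * ‖g‖ := by
    have h₁ := g.norm_coe_le_norm x
    have h₂ := g.norm_coe_le_norm y
    linarith [norm_sub_le (g x) (g y)]
  suffices H : ∀ (n : ℕ) (x a : UnitAddCircle),
      (∀ j ≤ n, dist (doubling^[j] x) (doubling^[j] a) ≤ 2 ^ j / 2 ^ n) →
      ‖birkhoffSum doubling g n x - birkhoffSum doubling g n a‖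
        ≤ n * ε + 2 * ‖g‖ * (min n K : ℕ) by
    refine ⟨2 * ‖g‖ * K, fun n x a h => (H n x a h).trans ?_⟩
    gcongr
    exact min_le_right _ _
  intro n
  induction n with
  | zero => simp
  | succ n ih =>
    intro x a h
    have h' := ih (doubling x) (doubling a) fun j hj => by
      have := h (j + 1) (by lia)
      rwa [Function.iterate_succ_apply, Function.iterate_succ_apply, pow_succ, pow_succ,
        mul_div_mul_right _ _ two_ne_zero] at this
    rw [birkhoffSum_succ', birkhoffSum_succ', add_sub_add_comm]
    refine (norm_add_le _ _).trans ?_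
    rcases le_or_gt K n with hn | hn
    · have h0 : dist x a < δ := by
        refine lt_of_le_of_lt (h 0 (by lia)) (lt_of_le_of_lt ?_ hK)
        rw [pow_zero, ← one_div_pow]
        exact pow_le_pow_of_le_one (by norm_num) (by norm_num) (by lia)
      have h1 := hg h0
      rw [dist_eq_norm] at h1
      rw [min_eq_right hn] at h'
      rw [min_eq_right (by lia)]
      push_cast
      linarith
    · rw [min_eq_left hn.le] at h'
      rw [min_eq_left (by lia)]
      push_cast
      linarith [hC x a]

/-- Every point `b` has an `n`-th preimage under the doubling map along whose first `n` iterates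
the sum of `g` is `e`-close to `w`. -/
def Reach (g : UnitAddCircle → E) (n : ℕ) (w : E) (e : ℝ) : Prop :=
  ∀ b, ∃ x, doubling^[n] x = b ∧ ‖birkhoffSum doubling g n x - w‖ ≤ e

lemma Reach.mono {g : UnitAddCircle → E} {n : ℕ} {w w' : E} {e e' : ℝ} (h : Reach g n w e)
    (h' : e + ‖w - w'‖ ≤ e') : Reach g n w' e' := by
  intro b
  obtain ⟨x, hx, hx'⟩ := h b
  refine ⟨x, hx, ?_⟩
  have := norm_sub_le_norm_sub_add_norm_sub (birkhoffSum doubling g n x) w w'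
  linarith

/-- Blocks are glued backwards: the start of the second is the prescribed endpoint of the first. -/
lemma Reach.add {g : UnitAddCircle → E} {m n : ℕ} {v w : E} {d e : ℝ} (hm : Reach g m v d)
    (hn : Reach g n w e) : Reach g (m + n) (v + w) (d + e) := by
  intro b
  obtain ⟨y, hy, hy'⟩ := hn b
  obtain ⟨x, hx, hx'⟩ := hm y
  refine ⟨x, by rw [add_comm, Function.iterate_add_apply, hx, hy], ?_⟩
  rw [birkhoffSum_add, hx, add_sub_add_comm]
  exact (norm_add_le _ _).trans (add_le_add hx' hy')

variable [NormedSpace ℝ E]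

lemma Reach.nsmul {g : UnitAddCircle → E} {n : ℕ} {w : E} {e : ℝ} (h : Reach g n w e) (m : ℕ) :
    Reach g (m * n) ((m : ℝ) • w) (m * e) := by
  induction m with
  | zero => intro b; exact ⟨b, by simp⟩
  | succ m ih =>
    have := ih.add h
    rw [Nat.succ_mul]
    convert this using 1
    · push_cast; rw [add_smul, one_smul]
    · push_cast; ring

/-- The vectors that are `ε`-close to averages of `g` along orbit segments which may be followed
by any prescribed point. -/
def reachableAverages (g : UnitAddCircle → E) (ε : ℝ) : Set E :=
  {v | ∃ n : ℕ, 0 < n ∧ Reach g n ((n : ℝ) • v) (n * ε)}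

lemma smul_add_smul_mem_reachableAverages {g : UnitAddCircle → E} {ε : ℝ} {v w : E}
    (hv : v ∈ reachableAverages g ε) (hw : w ∈ reachableAverages g ε) {p k : ℕ} (hk : 0 < k)
    (hp : p ≤ k) :
    ((p : ℝ) / k) • v + (1 - (p : ℝ) / k) • w ∈ reachableAverages g ε := by
  obtain ⟨m, hm, hv⟩ := hv
  obtain ⟨n, hn, hw⟩ := hw
  obtain ⟨q, rfl⟩ := Nat.exists_eq_add_of_le hp
  have hk' : (p : ℝ) + q ≠ 0 := by exact_mod_cast hk.ne'
  -- Repeating the blocks `p * n` and `q * m` times gives them time shares in the ratio `p : q`.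
  refine ⟨(p + q) * m * n, by positivity, ?_⟩
  convert (hv.nsmul (p * n)).add (hw.nsmul (q * m)) using 1
  · ring
  · simp only [smul_add, smul_smul]
    push_cast
    congr 2 <;> field_simp
    ring
  · push_cast
    ring

lemma convex_closure_reachableAverages (g : UnitAddCircle → E) (ε : ℝ) :
    Convex ℝ (closure (reachableAverages g ε)) := by
  intro v hv w hw a b ha hb hab
  obtain rfl : b = 1 - a := by linarith
  have hcont : Continuous (Function.uncurry fun x y : E => a • x + (1 - a) • y) := by
    fun_prop
  refine closure_closure.subset
    (map_mem_closure₂ (f := fun x y => a • x + (1 - a) • y) hcont hv hw fun x hx y hy => ?_)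
  have hlim : Tendsto (fun k : ℕ => ((⌊a * k⌋₊ : ℝ) / k)) atTop (nhds a) :=
    (tendsto_nat_floor_mul_div_atTop ha).comp tendsto_natCast_atTop_atTop
  refine mem_closure_of_tendsto ((hlim.smul_const x).add ((hlim.const_sub 1).smul_const y)) ?_
  filter_upwards [eventually_gt_atTop 0] with k hk
  refine smul_add_smul_mem_reachableAverages hx hy hk (Nat.floor_le_of_le ?_)
  exact mul_le_of_le_one_left (by positivity) (by linarith)

lemma IsDoublingInvariant.measurePreserving {μ : Measure UnitAddCircle}
    (hμ : IsDoublingInvariant μ) : MeasurePreserving doubling μ μ := hμ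

lemma integral_comp_of_measurePreserving {X : Type*} [TopologicalSpace X] [CompactSpace X]
    [MeasurableSpace X] [BorelSpace X] {μ : Measure X} {f : X → X} (hf : MeasurePreserving f μ μ)
    {g : X → E} (hg : AEStronglyMeasurable g μ) :
    ∫ x, g (f x) ∂μ = ∫ x, g x ∂μ := by
  rw [← integral_map (φ := f) hf.measurable.aemeasurable (by rwa [hf.map_eq]), hf.map_eq]

lemma integral_birkhoffSum {X : Type*} [TopologicalSpace X] [CompactSpace X]
    [MeasurableSpace X] [BorelSpace X] {μ : Measure X} [IsFiniteMeasure μ] {f : X → X}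
    (hf : MeasurePreserving f μ μ) {g : X → E} (hg : Integrable g μ) (n : ℕ) :
    Integrable (birkhoffSum f g n) μ ∧
      ∫ x, birkhoffSum f g n x ∂μ = (n : ℝ) • ∫ x, g x ∂μ := by
  have hi (j : ℕ) : Integrable (fun x => g (f^[j] x)) μ :=
    (hf.iterate j).integrable_comp_of_integrable hg
  refine ⟨integrable_finsetSum _ fun j _ => hi j, ?_⟩
  simp only [birkhoffSum]
  rw [integral_finsetSum _ fun j _ => hi j]
  simp_rw [fun j => integral_comp_of_measurePreserving (hf.iterate j) hg.aestronglyMeasurable]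
  simp [← Nat.cast_smul_eq_nsmul ℝ]

variable [CompleteSpace E]

/-- By invariance `∫ g ∂μ` is the mean of the `n`-step averages. Each of these is attainable by
shadowing, and a closed convex set contains the mean of its values. -/
lemma integral_mem_reachableAverages {μ : Measure UnitAddCircle} [IsProbabilityMeasure μ]
    (hμ : IsDoublingInvariant μ) (g : C(UnitAddCircle, E)) {ε : ℝ} (hε : 0 < ε) :
    ∫ x, g x ∂μ ∈ reachableAverages g ε := by
  have hg : Integrable g μ := g.continuous.integrable_of_hasCompactSupport
    (HasCompactSupport.of_compactSpace _)
  obtain ⟨B, hB⟩ := exists_norm_birkhoffSum_sub_le g (show 0 < ε / 4 by positivity)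
  obtain ⟨n, hn⟩ := exists_nat_gt (max 0 (B / (ε / 4)))
  have hn0 : (0 : ℝ) < n := (le_max_left _ _).trans_lt hn
  have hnB : B ≤ n * (ε / 4) :=
    ((div_lt_iff₀ (by positivity)).1 ((le_max_right _ _).trans_lt hn)).le
  have hmem (a : UnitAddCircle) :
      (n : ℝ)⁻¹ • birkhoffSum doubling g n a ∈ reachableAverages g (ε / 2) := by
    refine ⟨n, by exact_mod_cast hn0, fun b => ?_⟩
    obtain ⟨x, hx, hx'⟩ := exists_iterate_doubling_eq_and_dist_le a b n
    refine ⟨x, hx, ?_⟩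
    rw [smul_inv_smul₀ hn0.ne']
    linarith [hB n x a hx']
  obtain ⟨hint, hval⟩ := integral_birkhoffSum hμ.measurePreserving hg n
  have hcl := (convex_closure_reachableAverages g (ε / 2)).integral_mem isClosed_closure
    (Eventually.of_forall fun a => subset_closure (hmem a)) (hint.smul (n : ℝ)⁻¹)
  rw [integral_smul, hval, inv_smul_smul₀ hn0.ne'] at hcl
  obtain ⟨v, ⟨m, hm, hv⟩, hdist⟩ := Metric.mem_closure_iff.1 hcl (ε / 2) (by positivity)
  refine ⟨m, hm, hv.mono ?_⟩
  rw [← smul_sub, norm_smul, Real.norm_natCast, ← dist_eq_norm, dist_comm]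
  have := mul_le_mul_of_nonneg_left hdist.le (Nat.cast_nonneg' (α := ℝ) m)
  linarith

lemma exists_birkhoffSum_sub_integral_le {μ : Measure UnitAddCircle} [IsProbabilityMeasure μ]
    (hμ : IsDoublingInvariant μ) (g : C(UnitAddCircle, E)) {ε : ℝ} (hε : 0 < ε)
    (a : UnitAddCircle) {δ : ℝ} (hδ : 0 < δ) (N₀ : ℕ) :
    ∃ x, dist x a < δ ∧ ∃ N ≥ N₀, 0 < N ∧
      ‖birkhoffSum doubling g N x - (N : ℝ) • ∫ y, g y ∂μ‖ ≤ N * ε := by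
  obtain ⟨n, hn, hr⟩ := integral_mem_reachableAverages hμ g (show 0 < ε / 2 by positivity)
  obtain ⟨p, hp⟩ := exists_pow_lt_of_lt_one hδ (by norm_num : (1 / 2 : ℝ) < 1)
  set v := ∫ y, g y ∂μ
  -- The first `p` steps follow `a` to stay near it; `m` is large enough to absorb their
  -- contribution.
  obtain ⟨m, hm⟩ := exists_nat_gt (max (N₀ : ℝ) (p * (‖g‖ + ‖v‖) / (ε / 2)))
  have hmN : N₀ < m := by exact_mod_cast (le_max_left _ _).trans_lt hm
  have hmB : p * (‖g‖ + ‖v‖) ≤ m * (ε / 2) :=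
    ((div_lt_iff₀ (by positivity)).1 ((le_max_right _ _).trans_lt hm)).le
  have hmn : m ≤ m * n := Nat.le_mul_of_pos_right m hn
  obtain ⟨y, -, hy⟩ := hr.nsmul m 0
  obtain ⟨x, hx, hx'⟩ := exists_iterate_doubling_eq_and_dist_le a y p
  refine ⟨x, ?_, p + m * n, by lia, by lia, ?_⟩
  · refine (hx' 0 p.zero_le).trans_lt ?_
    simpa [← one_div_pow] using hp
  · have hpre : ‖birkhoffSum doubling g p x‖ ≤ p * ‖g‖ := by
      have := norm_sum_le_of_le (Finset.range p) (f := fun k => g (doubling^[k] x))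
        fun k _ => g.norm_coe_le_norm _
      simpa [birkhoffSum] using this
    have hpv : ‖(p : ℝ) • v‖ = p * ‖v‖ := by rw [norm_smul, Real.norm_natCast]
    have hsplit : birkhoffSum doubling g (p + m * n) x - ((p + m * n : ℕ) : ℝ) • v
        = (birkhoffSum doubling g p x - (p : ℝ) • v)
          + (birkhoffSum doubling g (m * n) y - (m : ℝ) • (n : ℝ) • v) := by
      rw [birkhoffSum_add, hx, smul_smul, Nat.cast_add, Nat.cast_mul, add_smul]
      abel
    rw [hsplit]
    have h1 := norm_add_le (birkhoffSum doubling g p x - (p : ℝ) • v)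
      (birkhoffSum doubling g (m * n) y - (m : ℝ) • (n : ℝ) • v)
    have h2 := norm_sub_le (birkhoffSum doubling g p x) ((p : ℝ) • v)
    have h3 : (m : ℝ) * (ε / 2) ≤ (m * n : ℕ) * (ε / 2) := by gcongr
    have h4 : 0 ≤ (p : ℝ) * ε := by positivity
    push_cast at h3 ⊢
    linarith

end Reach

/-! ### Empirical measures and weak neighbourhoods -/

lemma mem_accumulationPoints_of_continuous {ι X Y : Type*} [Preorder ι] [TopologicalSpace X]
    [TopologicalSpace Y] {h : X → Y} (hh : Continuous h) {u : ι → X} {v : ι → Y}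
    (huv : ∀ i, h (u i) = v i) {p : X} (hp : p ∈ accumulationPoints u) :
    h p ∈ accumulationPoints v := by
  simp only [accumulationPoints, mem_iInter] at hp ⊢
  intro i
  refine map_mem_closure hh (hp i) ?_
  rintro _ ⟨j, hj, rfl⟩
  exact ⟨j, hj, (huv j).symm⟩

section Empirical

variable {X : Type*} [TopologicalSpace X] [MeasurableSpace X] [OpensMeasurableSpace X]

lemma integral_empiricalMeasure {E : Type*} [NormedAddCommGroup E] [NormedSpace ℝ E]
    [CompleteSpace E] [T1Space X] (x : ℕ → X) (N : ℕ+) {f : X → E} :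
    ∫ y, f y ∂(empiricalMeasure x N) = (N : ℝ)⁻¹ • ∑ n ∈ Finset.Icc 1 (N : ℕ), f (x n) := by
  rw [empiricalMeasure, integral_smul_measure, integral_finsetSum_measure]
  · simp
  · exact fun n _ => integrable_dirac (by simp)

/-- Packing the finitely many test functions into one vector-valued `F` lets one orbit serve all of
them. -/
lemma exists_forall_norm_integral_sub_lt_mem [CompactSpace X] {μ : ProbabilityMeasure X}
    {U : Set (ProbabilityMeasure X)} (hU : U ∈ nhds μ) :
    ∃ (s : Finset (BoundedContinuousFunction X ℝ)) (F : C(X, {f // f ∈ s} → ℝ)) (ε : ℝ), 0 < ε ∧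
      ∀ ν : ProbabilityMeasure X, ‖∫ x, F x ∂(ν : Measure X) - ∫ x, F x ∂(μ : Measure X)‖ < ε →
        ν ∈ U := by
  let Ψ : ProbabilityMeasure X → BoundedContinuousFunction X ℝ → ℝ :=
    fun ν f => ∫ x, f x ∂(ν : Measure X)
  have hid : Tendsto id (comap Ψ (nhds (Ψ μ))) (nhds μ) := by
    rw [ProbabilityMeasure.tendsto_iff_forall_integral_tendsto]
    exact fun f => ((continuous_apply f).tendsto (Ψ μ)).comp tendsto_comap
  obtain ⟨V, hV, hVU⟩ := mem_comap.1 (hid hU)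
  rw [nhds_pi, Filter.mem_pi'] at hV
  obtain ⟨s, t, ht, htV⟩ := hV
  let F : C(X, {f // f ∈ s} → ℝ) :=
    ⟨fun x f => (f : BoundedContinuousFunction X ℝ) x, by fun_prop⟩
  have hF (ν : ProbabilityMeasure X) (f : {f // f ∈ s}) :
      (∫ x, F x ∂(ν : Measure X)) f = Ψ ν f :=
    eval_integral (f := fun x => F x)
      (fun f : {f // f ∈ s} => (f : BoundedContinuousFunction X ℝ).integrable _) f
  have hW : {w : {f // f ∈ s} → ℝ | ∀ f : {f // f ∈ s}, w f ∈ t f}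
      ∈ nhds (∫ x, F x ∂(μ : Measure X)) := by
    have : {w : {f // f ∈ s} → ℝ | ∀ f : {f // f ∈ s}, w f ∈ t f}
        = univ.pi fun f : {f // f ∈ s} => t f := by ext; simp
    rw [this]
    refine set_pi_mem_nhds finite_univ fun f _ => ?_
    rw [hF]
    exact ht f
  obtain ⟨ε, hε, hball⟩ := Metric.mem_nhds_iff.1 hW
  refine ⟨s, F, ε, hε, fun ν hν => hVU (htV fun f hf => ?_)⟩
  have := hball (mem_ball_iff_norm.2 hν) (⟨f, hf⟩ : {f // f ∈ s})
  rwa [hF] at this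

end Empirical

/-! ### Generic limit measures along powers of two -/

lemma sum_multiples_two_pow {E : Type*} [AddCommMonoid E] (f : UnitAddCircle → E)
    (α : UnitAddCircle) (N : ℕ) :
    ∑ n ∈ Finset.Icc 1 N, f (multiples (fun k => 2 ^ k) α n)
      = birkhoffSum doubling (f ∘ doubling) N α := by
  rw [birkhoffSum, Finset.range_eq_Ico, ← Finset.Ico_add_one_right_eq_Icc,
    ← Finset.sum_Ico_add' _ 0 N 1]
  simp only [multiples, Function.comp_apply, ← iterate_doubling, Function.iterate_succ_apply',
    Nat.Ico_zero_eq_range]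

lemma isDoublingInvariant_of_mem_limitMeasures {α : UnitAddCircle}
    {μ : ProbabilityMeasure UnitAddCircle}
    (hμ : μ ∈ limitMeasures (multiples (fun k => 2 ^ k) α)) :
    IsDoublingInvariant (μ : Measure UnitAddCircle) := by
  refine ⟨continuous_doubling.measurable, ?_⟩
  have : IsProbabilityMeasure ((μ : Measure UnitAddCircle).map doubling) :=
    Measure.isProbabilityMeasure_map continuous_doubling.aemeasurable
  refine ext_of_forall_integral_eq_of_IsFiniteMeasure fun f => ?_
  change ∫ x, f x ∂((μ : Measure UnitAddCircle).map doubling) = _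
  rw [integral_map continuous_doubling.aemeasurable f.continuous.aestronglyMeasurable]
  let g : BoundedContinuousFunction UnitAddCircle ℝ := f.compContinuous ⟨_, continuous_doubling⟩
  have hΦ : Continuous fun ν : ProbabilityMeasure UnitAddCircle =>
      |∫ x, g x ∂(ν : Measure UnitAddCircle) - ∫ x, f x ∂(ν : Measure UnitAddCircle)| :=
    ((ProbabilityMeasure.continuous_integral_boundedContinuousFunction g).sub
      (ProbabilityMeasure.continuous_integral_boundedContinuousFunction f)).abs
  have hle (N₀ : ℕ+) : |∫ x, g x ∂(μ : Measure UnitAddCircle)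
      - ∫ x, f x ∂(μ : Measure UnitAddCircle)| ≤ 2 * ‖f‖ / (N₀ : ℕ) := by
    refine (closure_minimal (t := {ν : ProbabilityMeasure UnitAddCircle |
      |∫ x, g x ∂(ν : Measure UnitAddCircle) - ∫ x, f x ∂(ν : Measure UnitAddCircle)|
        ≤ 2 * ‖f‖ / (N₀ : ℕ)}) ?_ (isClosed_le hΦ continuous_const)) (mem_iInter.1 hμ N₀)
    rintro _ ⟨N, hN, rfl⟩
    have hN' : (N₀ : ℝ) ≤ N := by exact_mod_cast hN
    change |∫ x, g x ∂(empiricalMeasure _ N) - ∫ x, f x ∂(empiricalMeasure _ N)| ≤ _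
    rw [integral_empiricalMeasure, integral_empiricalMeasure, ← smul_sub, sum_multiples_two_pow,
      sum_multiples_two_pow]
    have hg : (g ∘ doubling : UnitAddCircle → ℝ) = (f ∘ doubling) ∘ doubling := rfl
    have hcomm : birkhoffSum doubling ((f ∘ doubling) ∘ doubling) N α
        = birkhoffSum doubling (f ∘ doubling) N (doubling α) := by
      refine Finset.sum_congr rfl fun k _ => ?_
      simp only [Function.comp_apply]
      rw [← Function.iterate_succ_apply' doubling k, Function.iterate_succ_apply]
    -- The two sums telescope to a boundary term bounded by `2 * ‖f‖`.
    rw [hg, hcomm, birkhoffSum_apply_sub_birkhoffSum, smul_eq_mul, abs_mul, abs_inv,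
      Nat.abs_cast, inv_mul_eq_div]
    have hb : |(f ∘ doubling) (doubling^[N] α) - (f ∘ doubling) α| ≤ 2 * ‖f‖ :=
      f.dist_le_two_norm _ _
    have : (0 : ℝ) < N₀ := by exact_mod_cast N₀.pos
    gcongr
  have h0 : |∫ x, g x ∂(μ : Measure UnitAddCircle) - ∫ x, f x ∂(μ : Measure UnitAddCircle)| ≤ 0 :=
    ge_of_tendsto' ((tendsto_const_div_atTop_nhds_zero_nat (2 * ‖f‖)).comp (tendsto_add_atTop_nat 1))
      fun n : ℕ => by simpa using hle n.succPNat
  exact sub_eq_zero.1 (abs_nonpos_iff.1 h0)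

lemma continuous_empiricalProbabilityMeasure_multiples (n : ℕ → ℕ) (N : ℕ+) :
    Continuous fun α => empiricalProbabilityMeasure (multiples n α) N := by
  rw [ProbabilityMeasure.continuous_iff_forall_continuous_integral]
  intro f
  change Continuous fun α => ∫ y, f y ∂(empiricalMeasure (multiples n α) N)
  simp only [integral_empiricalMeasure, multiples]
  fun_prop

lemma dense_setOf_exists_empiricalProbabilityMeasure_mem
    {U : Set (ProbabilityMeasure UnitAddCircle)}
    (hU : IsOpen U) {μ : ProbabilityMeasure UnitAddCircle} (hμU : μ ∈ U)
    (hμ : IsDoublingInvariant (μ : Measure UnitAddCircle)) (N₀ : ℕ+) :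
    Dense {α | ∃ N ≥ N₀, empiricalProbabilityMeasure (multiples (fun k => 2 ^ k) α) N ∈ U} := by
  obtain ⟨s, F, ε, hε, hF⟩ := exists_forall_norm_integral_sub_lt_mem (hU.mem_nhds hμU)
  rw [Metric.dense_iff]
  intro a δ hδ
  obtain ⟨x, hx, N', hN, hN0, hxN⟩ := exists_birkhoffSum_sub_integral_le hμ
    (F.comp ⟨doubling, continuous_doubling⟩) (half_pos hε) a hδ N₀
  lift N' to ℕ+ using hN0 with N
  refine ⟨x, hx, N, hN, hF _ ?_⟩
  have hN' : (0 : ℝ) < N := by exact_mod_cast N.pos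
  change ‖∫ y, F y ∂(empiricalMeasure _ _) - _‖ < ε
  rw [integral_empiricalMeasure, sum_multiples_two_pow]
  simp only [ContinuousMap.comp_apply, ContinuousMap.coe_mk, ContinuousMap.coe_comp] at hxN
  rw [integral_comp_of_measurePreserving hμ.measurePreserving
    F.continuous.aestronglyMeasurable] at hxN
  rw [← inv_smul_smul₀ hN'.ne' (∫ y, F y ∂(μ : Measure UnitAddCircle)), ← smul_sub, norm_smul,
    norm_inv, Real.norm_natCast, inv_mul_lt_iff₀ hN']
  exact hxN.trans_lt (by gcongr; linarith)

lemma eventually_residual_limitMeasures_two_pow :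
    ∀ᶠ α in residual UnitAddCircle, limitMeasures (multiples (fun k => 2 ^ k) α)
      = {μ : ProbabilityMeasure UnitAddCircle | IsDoublingInvariant (μ : Measure UnitAddCircle)} := by
  let _ := TopologicalSpace.pseudoMetrizableSpacePseudoMetric (ProbabilityMeasure UnitAddCircle)
  have : SecondCountableTopology (ProbabilityMeasure UnitAddCircle) := inferInstance
  let B := TopologicalSpace.countableBasis (ProbabilityMeasure UnitAddCircle)
  have hB : TopologicalSpace.IsTopologicalBasis B := TopologicalSpace.isBasis_countableBasis _
  have key : ∀ᶠ α in residual UnitAddCircle, ∀ U ∈ B, ∀ N₀ : ℕ+,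
      (∃ μ ∈ U, IsDoublingInvariant (μ : Measure UnitAddCircle)) →
      ∃ N ≥ N₀, empiricalProbabilityMeasure (multiples (fun k => 2 ^ k) α) N ∈ U := by
    refine (eventually_countable_ball (TopologicalSpace.countable_countableBasis _)).2
      fun U hUB => eventually_countable_forall.2 fun N₀ => ?_
    have hU := hB.isOpen hUB
    by_cases h : ∃ μ ∈ U, IsDoublingInvariant (μ : Measure UnitAddCircle)
    · obtain ⟨μ, hμU, hμ⟩ := h
      refine mem_of_superset (residual_of_dense_open ?_
        (dense_setOf_exists_empiricalProbabilityMeasure_mem hU hμU hμ N₀)) fun α hα _ => hα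
      have : {α | ∃ N ≥ N₀, empiricalProbabilityMeasure (multiples (fun k => 2 ^ k) α) N ∈ U}
          = ⋃ N ≥ N₀,
            (fun α => empiricalProbabilityMeasure (multiples (fun k => 2 ^ k) α) N) ⁻¹' U := by
        ext; simp
      rw [this]
      exact isOpen_biUnion fun N _ =>
        hU.preimage (continuous_empiricalProbabilityMeasure_multiples _ N)
    · exact Eventually.of_forall fun α h' => absurd h' h
  filter_upwards [key] with α hα
  refine Subset.antisymm (fun μ hμ => isDoublingInvariant_of_mem_limitMeasures hμ)
    fun μ hμ => mem_iInter.2 fun N₀ => hB.mem_closure_iff.2 fun U hU hμU => ?_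
  obtain ⟨N, hN, hNU⟩ := hα U hU N₀ ⟨μ, hμU, hμ⟩
  exact ⟨_, hNU, N, hN, rfl⟩

/-! ### Translation by `α` and the sequence `2^k + 1` -/

/-- The translate of a probability measure on `ℝ/ℤ` by `a`. -/
noncomputable def translateMeasure (a : UnitAddCircle) (μ : ProbabilityMeasure UnitAddCircle) :
    ProbabilityMeasure UnitAddCircle :=
  μ.map (f := (· + a)) (continuous_add_const a).aemeasurable

lemma continuous_translate (a : UnitAddCircle) : Continuous (translateMeasure a) :=
  ProbabilityMeasure.continuous_map (continuous_add_const a)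

lemma translateMeasure_apply (a : UnitAddCircle) (μ : ProbabilityMeasure UnitAddCircle)
    {s : Set UnitAddCircle} (hs : MeasurableSet s) :
    (translateMeasure a μ : Measure UnitAddCircle) s = (μ : Measure UnitAddCircle) ((· + a) ⁻¹' s) :=
  Measure.map_apply (continuous_add_const a).measurable hs

lemma translateMeasure_empiricalProbabilityMeasure (a : UnitAddCircle) (x : ℕ → UnitAddCircle) (N : ℕ+) :
    translateMeasure a (empiricalProbabilityMeasure x N)
      = empiricalProbabilityMeasure (fun n => x n + a) N := by
  apply Subtype.ext
  change (empiricalMeasure x N).map (· + a) = empiricalMeasure (fun n => x n + a) N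
  have hm : Measurable fun y : UnitAddCircle => y + a := (continuous_add_const a).measurable
  rw [empiricalMeasure, empiricalMeasure, Measure.map_smul, ← Measure.mapₗ_apply_of_measurable hm,
    map_sum]
  simp [Measure.mapₗ_apply_of_measurable hm, Measure.map_dirac' hm]

lemma multiples_two_pow_add_one (α : UnitAddCircle) :
    multiples (fun k => 2 ^ k + 1) α = fun n => multiples (fun k => 2 ^ k) α n + α := by
  ext n
  simp [multiples, add_smul]

lemma translate_mem_limitMeasures {α : UnitAddCircle} {μ : ProbabilityMeasure UnitAddCircle}
    (hμ : μ ∈ limitMeasures (multiples (fun k => 2 ^ k) α)) :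
    translateMeasure α μ ∈ limitMeasures (multiples (fun k => 2 ^ k + 1) α) := by
  refine mem_accumulationPoints_of_continuous (continuous_translate α) (fun N => ?_) hμ
  rw [translateMeasure_empiricalProbabilityMeasure, multiples_two_pow_add_one]

lemma translate_neg_mem_limitMeasures {α : UnitAddCircle} {μ : ProbabilityMeasure UnitAddCircle}
    (hμ : μ ∈ limitMeasures (multiples (fun k => 2 ^ k + 1) α)) :
    translateMeasure (-α) μ ∈ limitMeasures (multiples (fun k => 2 ^ k) α) := by
  refine mem_accumulationPoints_of_continuous (continuous_translate (-α)) (fun N => ?_) hμ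
  rw [translateMeasure_empiricalProbabilityMeasure, multiples_two_pow_add_one]
  simp

lemma isOpen_arc (a b : ℝ) : IsOpen (arc a b) :=
  QuotientAddGroup.isOpenMap_coe _ isOpen_Ioo

/-- The indicators of `J` and its first two preimages sum to at most 2, and all three have integral
`ν J`. -/
lemma measure_le_two_thirds_of_disjoint_iterates {X : Type*} [MeasurableSpace X] {ν : Measure X}
    [IsProbabilityMeasure ν] {f : X → X} (hf : MeasurePreserving f ν ν) {J : Set X}
    (hJ : MeasurableSet J) (h : ∀ x ∈ J, f x ∈ J → f (f x) ∉ J) : ν J ≤ 2 / 3 := by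
  have h1 : ν (f ⁻¹' J) = ν J := hf.measure_preimage hJ.nullMeasurableSet
  have h2 : ν (f ⁻¹' (f ⁻¹' J)) = ν J := by
    rw [hf.measure_preimage (hf.measurable hJ).nullMeasurableSet, h1]
  have hm := hf.measurable
  have key : ∫⁻ x, J.indicator 1 x + (f ⁻¹' J).indicator 1 x + (f ⁻¹' (f ⁻¹' J)).indicator 1 x ∂ν
      ≤ ∫⁻ _, (2 : ℝ≥0∞) ∂ν := by
    refine lintegral_mono fun x => ?_
    have := h x
    by_cases hx : x ∈ J <;> by_cases hx1 : f x ∈ J <;> by_cases hx2 : f (f x) ∈ J <;>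
      simp_all [one_add_one_eq_two]
  rw [lintegral_add_right _ (measurable_one.indicator (hm (hm hJ))),
    lintegral_add_right _ (measurable_one.indicator (hm hJ)), lintegral_indicator_one hJ,
    lintegral_indicator_one (hm hJ), lintegral_indicator_one (hm (hm hJ)), h1, h2] at key
  simp only [lintegral_const, measure_univ, mul_one] at key
  rw [ENNReal.le_div_iff_mul_le (by simp) (by simp)]
  calc ν J * 3 = ν J + ν J + ν J := by ring
    _ ≤ 2 := key

lemma coe_sub_two_mul_eq_zero {x : UnitAddCircle} {a s t : ℝ} (hs : (s : UnitAddCircle) = x + a)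
    (ht : (t : UnitAddCircle) = doubling x + a) :
    ((t - a - 2 * (s - a) : ℝ) : UnitAddCircle) = 0 := by
  rw [two_mul, AddCircle.coe_sub, AddCircle.coe_add, AddCircle.coe_sub, AddCircle.coe_sub, ht, hs,
    doubling, two_nsmul]
  abel

/-- Lifted to `ℝ`, doubling makes `t₂ - 2 * t₁ + a` an integer, while the bounds place it strictly
between -1 and 0. -/
lemma doubling_doubling_notMem_of_mem {α : UnitAddCircle} (hα : α ∈ arc 0 (1 / 16))
    {x : UnitAddCircle} (h0 : x + α ∈ arc (1 / 2) (3 / 4))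
    (h1 : doubling x + α ∈ arc (1 / 2) (3 / 4)) :
    doubling (doubling x) + α ∉ arc (1 / 2) (3 / 4) := by
  rintro ⟨t₂, ⟨ht₂, ht₂'⟩, h2⟩
  obtain ⟨t₀, ⟨ht₀, ht₀'⟩, h0⟩ := h0
  obtain ⟨t₁, ⟨ht₁, ht₁'⟩, h1⟩ := h1
  obtain ⟨a, ⟨ha, ha'⟩, rfl⟩ := hα
  have e1 := coe_sub_two_mul_eq_zero h0 h1
  have e2 := coe_sub_two_mul_eq_zero h1 h2
  obtain ⟨m, hm⟩ := (AddCircle.coe_eq_zero_iff 1).1 e1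
  obtain ⟨n, hn⟩ := (AddCircle.coe_eq_zero_iff 1).1 e2
  rw [zsmul_one] at hm hn
  have hm1 : (-2 : ℤ) < m := by
    have : (-2 : ℝ) < m := by linarith
    exact_mod_cast this
  have hm2 : m < (0 : ℤ) := by
    have : (m : ℝ) < 0 := by linarith
    exact_mod_cast this
  obtain rfl : m = -1 := by lia
  push_cast at hm
  have hn1 : (-1 : ℤ) < n := by
    have : (-1 : ℝ) < n := by linarith
    exact_mod_cast this
  have hn2 : n < (0 : ℤ) := by
    have : (n : ℝ) < 0 := by linarith
    exact_mod_cast this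
  lia

lemma measure_arc_le_of_mem_limitMeasures {α : UnitAddCircle} (hα : α ∈ arc 0 (1 / 16))
    {μ : ProbabilityMeasure UnitAddCircle}
    (hμ : μ ∈ limitMeasures (multiples (fun k => 2 ^ k + 1) α)) :
    (μ : Measure UnitAddCircle) (arc (1 / 2) (3 / 4)) ≤ 2 / 3 := by
  have hinv := isDoublingInvariant_of_mem_limitMeasures (translate_neg_mem_limitMeasures hμ)
  have hm : MeasurableSet ((· + α) ⁻¹' arc (1 / 2) (3 / 4)) :=
    ((isOpen_arc _ _).preimage (continuous_add_const α)).measurableSet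
  have := measure_le_two_thirds_of_disjoint_iterates hinv.measurePreserving hm
    fun x h0 h1 => doubling_doubling_notMem_of_mem hα h0 h1
  rw [translateMeasure_apply _ _ hm, ← preimage_comp] at this
  simpa [Function.comp_def] using this

lemma isDoublingInvariant_dirac_zero :
    IsDoublingInvariant (Measure.dirac (0 : UnitAddCircle)) := by
  refine ⟨continuous_doubling.measurable, ?_⟩
  exact (Measure.map_dirac' continuous_doubling.measurable 0).trans (by simp [doubling])

lemma eventually_residual_exists_measure_arc_eq_one :
    ∀ᶠ α in residual UnitAddCircle, α ∈ arc (1 / 2) (3 / 4) →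
      ∃ μ ∈ limitMeasures (multiples (fun k => 2 ^ k + 1) α),
        (μ : Measure UnitAddCircle) (arc (1 / 2) (3 / 4)) = 1 := by
  filter_upwards [eventually_residual_limitMeasures_two_pow] with α hα hαI
  let δ₀ : ProbabilityMeasure UnitAddCircle := ⟨Measure.dirac 0, inferInstance⟩
  have hδ₀ : δ₀ ∈ limitMeasures (multiples (fun k => 2 ^ k) α) := by
    rw [hα]
    exact isDoublingInvariant_dirac_zero
  refine ⟨translateMeasure α δ₀, translate_mem_limitMeasures hδ₀, ?_⟩
  rw [translateMeasure_apply _ _ (isOpen_arc _ _).measurableSet]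
  change Measure.dirac 0 _ = 1
  exact Measure.dirac_apply_of_mem (by simpa using hαI)

lemma exists_mem_arc_of_eventually_residual {p : UnitAddCircle → Prop}
    (hp : ∀ᶠ α in residual UnitAddCircle, p α) {a b : ℝ} (hab : a < b) :
    ∃ α ∈ arc a b, p α := by
  obtain ⟨α, hα, hα'⟩ := (dense_of_mem_residual hp).inter_open_nonempty _ (isOpen_arc a b)
    ((nonempty_Ioo.2 hab).image _)
  exact ⟨α, hα, hα'⟩

theorem mainTheorem4 :
    -- the sequence `n_k = 2^k`
    (∃ M : Set (ProbabilityMeasure UnitAddCircle),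
      (∀ μ : ProbabilityMeasure UnitAddCircle,
        μ ∈ M ↔ IsDoublingInvariant (μ : Measure UnitAddCircle)) ∧
      ∀ᶠ α in residual UnitAddCircle, limitMeasures (multiples (fun k => 2 ^ k) α) = M) ∧
    -- the sequence `n'_k = 2^k + 1`
    (¬ ∃ M' : Set (ProbabilityMeasure UnitAddCircle),
      ∀ᶠ α in residual UnitAddCircle, limitMeasures (multiples (fun k => 2 ^ k + 1) α) = M') ∧
    (∀ α ∈ arc 0 (1 / 16), ∀ μ ∈ limitMeasures (multiples (fun k => 2 ^ k + 1) α),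
      (μ : Measure UnitAddCircle) (arc (1 / 2) (3 / 4)) ≤ 5 / 6) ∧
    (∀ᶠ α in residual UnitAddCircle, α ∈ arc (1 / 2) (3 / 4) →
      ∃ μ ∈ limitMeasures (multiples (fun k => 2 ^ k + 1) α),
        (μ : Measure UnitAddCircle) (arc (1 / 2) (3 / 4)) = 1) := by
  have hle : ∀ α ∈ arc 0 (1 / 16), ∀ μ ∈ limitMeasures (multiples (fun k => 2 ^ k + 1) α),
      (μ : Measure UnitAddCircle) (arc (1 / 2) (3 / 4)) ≤ 5 / 6 := fun α hα μ hμ => by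
    refine (measure_arc_le_of_mem_limitMeasures hα hμ).trans ?_
    rw [ENNReal.div_le_iff (by simp) (by simp), ← ENNReal.mul_div_right_comm,
      ENNReal.le_div_iff_mul_le (by simp) (by simp)]
    norm_num
  refine ⟨⟨_, fun _ => Iff.rfl, eventually_residual_limitMeasures_two_pow⟩, ?_, hle,
    eventually_residual_exists_measure_arc_eq_one⟩
  -- Density of residual sets yields `α` and `β` in the two arcs with the same limit set `M'`,
  -- forcing `1 ≤ 5 / 6`.
  rintro ⟨M', hM'⟩
  obtain ⟨α, hαI, hα⟩ := exists_mem_arc_of_eventually_residual hM'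
    (show (0 : ℝ) < 1 / 16 by norm_num)
  obtain ⟨β, hβI, hβ, hβ'⟩ := exists_mem_arc_of_eventually_residual
    (hM'.and eventually_residual_exists_measure_arc_eq_one) (show (1 / 2 : ℝ) < 3 / 4 by norm_num)
  obtain ⟨μ, hμ, hμ1⟩ := hβ' hβI
  have h := hle α hαI μ (by rwa [hα, ← hβ])
  rw [hμ1, ENNReal.le_div_iff_mul_le (by simp) (by simp)] at h
  norm_num at h
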